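/- \textbf{Setting.} Let $\mathcal X\subset\mathbb R^d$ be closed and convex, and let $f_1,\dots,f_N:\mathbb R^d\to\mathbb R$ be convex functions, each $f_i$ being $L_i$-Lipschitz on $\mathcal X$. Let $f=\frac1N\sum_{i=1}^N f_i$ be $\mu$-strongly convex on $\mathcal X$ for some $\mu>0$, and let $\mathbf x^*\in\mathcal X$ be the minimizer of $f$ over $\mathcal X$. Write $\partial f_i(\mathbf x)=\{\mathbf g\in\mathbb R^d: f_i(\mathbf y)\ge f_i(\mathbf x)+\langle \mathbf g,\mathbf y-\mathbf x\rangle\ \forall \mathbf y\in\mathbb R^d\}$. Agents $1,\dots,N$ communicate over links $\mathcal E$ with weight matrix $\mathbf A=[a_{ij}]$, which is nonnegative, irreducible, aperiodic, symmetric and doubly stochastic, with $a_{ij}>0$ if and only if $(i,j)\in\mathcal E$; let $\mathcal N_i=\{j:(i,j)\in\mathcal E\}\cup\{i\}$. \textbf{Algorithm (GDSRQ).} Starting from $\mathbf x_{i,0}\in\mathcal X$ (possibly random), for $k=0,1,2,\dots$ $$\mathbf x_{i,k+1}=\mathcal P_{\mathcal X}\big[\mathbf v_{i,k}-\alpha_k\mathbf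 g_{i,k}\big],\qquad \mathbf v_{i,k}=(1-\beta_k)\mathbf x_{i,k}+\beta_k\sum_{j\in\mathcal N_i}a_{ij}\mathbf q_{j,k},$$ where $\mathcal P_{\mathcal X}$ is the Euclidean projection onto $\mathcal X$, $\mathbf g_{i,k}\in\partial f_i(\mathbf x_{i,k})$, and $\mathbf q_{j,k}$ is the random $b$-bit quantization of $\mathbf x_{j,k}$: if $\mathscr F_k$ denotes the information available in round $k$ before quantization (all iterates and subgradients up to round $k$, all quantized vectors up to round $k-1$), then, conditionally on $\mathscr F_k$, each coordinate $x$ of $\mathbf x_{j,k}$ is replaced by $\tau'=\tau+2^{-b}$ with probability $2^b(x-\tau)$ and by $\tau$ with probability $2^b(\tau'-x)$, where $\tau\le x<\tau'$ are the neighbouring points of the grid $2^{-b}\mathbb Z$. \textbf{Theorem.} Let the positive stepsizes $\{\alpha_k\}$, $\{\beta_k\}$ be decreasing (not necessarily strictly) with $$\lim_{k\to\infty}k\beta_k=\infty,\quad \limsup_{k\to\infty}\frac1{k\alpha_k}\le C,\quad \sum_{k=0}^\infty\beta_k^2<\infty,\quad \sum_{k=0}^\infty\frac{\alpha_k^2}{\beta_k}<\infty,\quad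 \sum_{k=0}^\infty\alpha_k=\infty,\quad \sum_{k=0}^\infty\beta_k=\infty$$ for some constant $C>0$. For $k\ge1$ and $0\le t\le k$ let the weights $0<\gamma_k^t<1$ satisfy $\sum_{t=0}^k\gamma_k^t=1$, $$\lim_{k\to\infty}\sum_{t=0}^k\frac{\gamma_k^t}{\alpha_t}\beta_t^2=0,\qquad \lim_{k\to\infty}\sum_{t=0}^k\frac{\gamma_k^t\alpha_t}{\beta_t}=0,$$ $$\frac{\gamma_k^{j+1}}{\alpha_{j+1}}(1-\mu\alpha_{j+1})\le\frac{\gamma_k^j}{\alpha_j}\quad(0\le j<k),\qquad \lim_{k\to\infty}\sum_{j=0}^{k-1}\left|\frac{\gamma_k^j}{\alpha_j}-\frac{\gamma_k^{j+1}}{\alpha_{j+1}}\right|=0.$$ Let $\mathbf z_{i,0}$ be arbitrary and $\mathbf z_{i,k}=\sum_{t=0}^k\gamma_k^t\mathbf x_{i,t}$ for $k\ge1$. Then for every agent $i$ $$\lim_{k\to\infty}\mathbf z_{i,k}=\mathbf x^*\ \text{ almost surely, and}\qquad \lim_{k\to\infty}\mathbb E\|\mathbf z_{i,k}-\mathbf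 x^*\|^2=0 .$$ -/

import Mathlib

open MeasureTheory Filter Topology

noncomputable section

namespace GDSRQ

/-- The subdifferential `∂f(x) = {g | f(y) ≥ f(x) + ⟨g, y - x⟩ for all y}` of a real-valued
function on `ℝᵈ`. -/
def subdifferential {d : ℕ} (f : EuclideanSpace ℝ (Fin d) → ℝ) (x : EuclideanSpace ℝ (Fin d)) :
    Set (EuclideanSpace ℝ (Fin d)) :=
  {g | ∀ y, f x + inner ℝ g (y - x) ≤ f y}

/-- `p` is the projection of `y` onto `X`, the point of `X` nearest to `y`. For a nonempty closed
convex `X` there is exactly one such point. -/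
def IsProjection {d : ℕ} (X : Set (EuclideanSpace ℝ (Fin d))) (y p : EuclideanSpace ℝ (Fin d)) :
    Prop :=
  p ∈ X ∧ ∀ w ∈ X, ‖y - p‖ ≤ ‖y - w‖

/-- The averaged objective `f = (1/N) ∑ᵢ fᵢ`. -/
def objective {N d : ℕ} (f : Fin N → EuclideanSpace ℝ (Fin d) → ℝ)
    (x : EuclideanSpace ℝ (Fin d)) : ℝ :=
  (1 / (N : ℝ)) * ∑ i, f i x

/-- A nonnegative matrix is aperiodic if, for every state `i`, the greatest common divisor of the
return times `{n ≥ 1 | (Aⁿ)ᵢᵢ > 0}` is `1`. -/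
def IsAperiodic {N : ℕ} (A : Matrix (Fin N) (Fin N) ℝ) : Prop :=
  ∀ i, ∀ p : ℕ, (∀ n : ℕ, 0 < n → 0 < (A ^ n) i i → p ∣ n) → p = 1

/-- Weight matrix `A` of a network with link set `E`: irreducible, symmetric, aperiodic and doubly
stochastic, with `aᵢⱼ > 0` exactly on the links. In particular the network is undirected
(by symmetry) and connected (by irreducibility). -/
structure IsNetworkMatrix {N : ℕ} (E : Set (Fin N × Fin N)) (A : Matrix (Fin N) (Fin N) ℝ) :
    Prop where
  irreducible : A.IsIrreducible
  symmetric : A.IsSymm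
  aperiodic : IsAperiodic A
  doubly_stochastic : A ∈ doublyStochastic ℝ (Fin N)
  pos_iff : ∀ i j, 0 < A i j ↔ (i, j) ∈ E

open Classical in
/-- The neighbours of agent `i`, including `i` itself. -/
def neighbors {N : ℕ} (E : Set (Fin N × Fin N)) (i : Fin N) : Finset (Fin N) :=
  Finset.univ.filter fun j => (i, j) ∈ E ∨ j = i

/-- The largest grid point `m / 2ᵇ` (`m ∈ ℤ`) that is at most `x`. -/
def quantLower (b : ℕ) (x : ℝ) : ℝ := (⌊2 ^ b * x⌋ : ℝ) / 2 ^ b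

/-- The next grid point, the smallest one that is strictly greater than `x`. -/
def quantUpper (b : ℕ) (x : ℝ) : ℝ := quantLower b x + 1 / 2 ^ b

/-- Given the information in the `σ`-algebra `m`, the random number `q` is a `b`-bit random
quantization of the `m`-measurable random number `x`: it equals the upper neighbouring grid point
of `x` with conditional probability `2ᵇ (x - lower)` and the lower one with conditional
probability `2ᵇ (upper - x)`. -/
def IsRandomQuantization {Ω : Type*} {mΩ : MeasurableSpace Ω} (P : Measure Ω)
    (m : MeasurableSpace Ω) (b : ℕ) (x q : Ω → ℝ) : Prop :=
  (P[Set.indicator {ω | q ω = quantUpper b (x ω)} (fun _ => (1 : ℝ)) | m]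
      =ᵐ[P] fun ω => 2 ^ b * (x ω - quantLower b (x ω))) ∧
  (P[Set.indicator {ω | q ω = quantLower b (x ω)} (fun _ => (1 : ℝ)) | m]
      =ᵐ[P] fun ω => 2 ^ b * (quantUpper b (x ω) - x ω))

/-- `v_i = (1 - β) x_i + β ∑_{j ∈ N_i} a_{ij} q_j`. -/
def mix {N d : ℕ} (E : Set (Fin N × Fin N)) (A : Matrix (Fin N) (Fin N) ℝ) (β : ℝ)
    (x q : Fin N → EuclideanSpace ℝ (Fin d)) (i : Fin N) : EuclideanSpace ℝ (Fin d) :=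
  (1 - β) • x i + β • ∑ j ∈ neighbors E i, A i j • q j

/-- A run of the generalized distributed subgradient method with random `b`-bit quantization.
`x k i`, `g k i` and `q k i` are the iterate, the subgradient and the transmitted quantized vector
of agent `i` in round `k`; `ℱ k` is the information available in round `k` before the
quantization, which acts on every coordinate of every iterate. -/
structure IsRun {Ω : Type*} {mΩ : MeasurableSpace Ω} (P : Measure Ω) (ℱ : Filtration ℕ mΩ)
    {N d : ℕ} (X : Set (EuclideanSpace ℝ (Fin d))) (f : Fin N → EuclideanSpace ℝ (Fin d) → ℝ)
    (E : Set (Fin N × Fin N)) (A : Matrix (Fin N) (Fin N) ℝ) (b : ℕ) (α β : ℕ → ℝ)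
    (x g q : ℕ → Fin N → Ω → EuclideanSpace ℝ (Fin d)) : Prop where
  measurable_iterate : ∀ k i, Measurable[ℱ k] (x k i)
  measurable_subgradient : ∀ k i, Measurable[ℱ k] (g k i)
  measurable_quantized : ∀ k i, Measurable[ℱ (k + 1)] (q k i)
  initial_mem : ∀ i ω, x 0 i ω ∈ X
  subgradient_mem : ∀ k i ω, g k i ω ∈ subdifferential (f i) (x k i ω)
  quantized : ∀ k i (c : Fin d),
    IsRandomQuantization P (ℱ k) b (fun ω => x k i ω c) (fun ω => q k i ω c)
  update : ∀ k i ω,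
    IsProjection X (mix E A (β k) (fun j => x k j ω) (fun j => q k j ω) i - α k • g k i ω)
      (x (k + 1) i ω)

/-- The conditions on the decreasing stepsizes. -/
structure StepsizeConditions (α β : ℕ → ℝ) (C : ℝ) : Prop where
  alpha_pos : ∀ k, 0 < α k
  beta_pos : ∀ k, 0 < β k
  alpha_decreasing : Antitone α
  beta_decreasing : Antitone β
  k_mul_beta : Tendsto (fun k : ℕ => (k : ℝ) * β k) atTop atTop
  limsup_le : limsup (fun k : ℕ => ((1 / ((k : ℝ) * α k) : ℝ) : EReal)) atTop ≤ (C : EReal)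
  beta_sq : Summable fun k => β k ^ 2
  alpha_sq_div_beta : Summable fun k => α k ^ 2 / β k
  alpha_sum : Tendsto (fun n => ∑ k ∈ Finset.range n, α k) atTop atTop
  beta_sum : Tendsto (fun n => ∑ k ∈ Finset.range n, β k) atTop atTop

/-- The conditions on the time-average weights `γ k t = γ_k^t`, `0 ≤ t ≤ k`, `k ≥ 1`. (For `k = 0`
the requirements `γ_0^0 = 1` and `γ_0^0 < 1` would contradict each other.) -/
structure WeightConditions (α β : ℕ → ℝ) (μ : ℝ) (γ : ℕ → ℕ → ℝ) : Prop where
  pos : ∀ k t, 1 ≤ k → t ≤ k → 0 < γ k t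
  lt_one : ∀ k t, 1 ≤ k → t ≤ k → γ k t < 1
  sum_eq_one : ∀ k, 1 ≤ k → ∑ t ∈ Finset.range (k + 1), γ k t = 1
  beta_term : Tendsto (fun k => ∑ t ∈ Finset.range (k + 1), γ k t / α t * β t ^ 2) atTop (𝓝 0)
  alpha_term : Tendsto (fun k => ∑ t ∈ Finset.range (k + 1), γ k t * α t / β t) atTop (𝓝 0)
  monotone : ∀ k j, 1 ≤ k → j + 1 ≤ k →
    γ k (j + 1) / α (j + 1) * (1 - μ * α (j + 1)) ≤ γ k j / α j
  variation : Tendsto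
    (fun k => ∑ j ∈ Finset.range k, |γ k j / α j - γ k (j + 1) / α (j + 1)|) atTop (𝓝 0)

end GDSRQ

end

noncomputable section

namespace GDSRQ

/-! The iterates themselves, not only their averages, converge almost surely to the minimizer `w`.
Strong convexity makes `f` grow quadratically away from `w`, while Lipschitz continuity allows only
linear growth. So `X` is bounded, and with it all iterates and the subgradients taken on `X`.

Let `V_k = ∑ᵢ ‖x_{i,k} - w‖²`. In one round the consensus step lowers `V` by `β` times the
disagreement, which a Poincaré inequality on the connected network bounds below. The subgradient
step lowers it by `α` times the squared distance of one reference agent to `w`. Together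
(`one_step`) they give `V_{k+1} ≤ V_k - c min(α_k, β_k) V_k + K(α_k²/β_k + β_k²) + noise`. The noise
is linear in the quantization errors, so it has conditional mean zero (`condExp_noise`). The errors
are summable and `min(α_k, β_k)` is not, so supermartingale convergence
(`ae_tendsto_zero_of_condExp_le`) forces `V_k → 0`.

Each single weight `γ_k^t` vanishes as `k → ∞`, so the averages inherit the limit. Boundedness of
`X` upgrades this to mean square by dominated convergence. -/

theorem IsProjection.inner_nonpos {d : ℕ} {X : Set (EuclideanSpace ℝ (Fin d))}
    (hX : Convex ℝ X) {y p w : EuclideanSpace ℝ (Fin d)} (hp : IsProjection X y p) (hw : w ∈ X) :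
    inner ℝ (y - p) (w - p) ≤ 0 := by
  refine (norm_eq_iInf_iff_real_inner_le_zero hX hp.1).1 ?_ w hw
  have : Nonempty X := ⟨⟨p, hp.1⟩⟩
  refine le_antisymm (le_ciInf fun w => hp.2 w w.2) ?_
  exact ciInf_le (f := fun w : X => ‖y - w‖)
    ⟨0, by rintro _ ⟨w, rfl⟩; exact norm_nonneg _⟩ ⟨p, hp.1⟩

theorem IsProjection.norm_sub_le {d : ℕ} {X : Set (EuclideanSpace ℝ (Fin d))}
    (hX : Convex ℝ X) {y p w : EuclideanSpace ℝ (Fin d)} (hp : IsProjection X y p) (hw : w ∈ X) :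
    ‖p - w‖ ^ 2 ≤ ‖y - w‖ ^ 2 := by
  have h := hp.inner_nonpos hX hw
  have e : y - w = (y - p) - (w - p) := by abel
  rw [e, norm_sub_sq_real (y - p), norm_sub_rev p w]
  nlinarith [sq_nonneg ‖y - p‖]

/-! ### Strong convexity: boundedness of the feasible set and of the subgradients -/

/-- The quadratic growth of a strongly convex function at a minimizer. -/
theorem quadratic_growth {F : Type*} [NormedAddCommGroup F] [NormedSpace ℝ F] {X : Set F}
    {μ : ℝ} {f : F → ℝ} (hf : StrongConvexOn X μ f) {x y : F} (hx : x ∈ X) (hy : y ∈ X)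
    (hmin : IsMinOn f X x) : μ / 4 * ‖y - x‖ ^ 2 ≤ f y - f x := by
  obtain ⟨hc, hf⟩ := hf
  -- The midpoint alone suffices; it costs a factor 2 against the sharp constant `μ / 2`.
  have h := hf hx hy (a := 1 / 2) (b := 1 / 2) (by norm_num) (by norm_num) (by norm_num)
  have h2 : f x ≤ f ((1 / 2 : ℝ) • x + (1 / 2 : ℝ) • y) :=
    hmin (hc hx hy (by norm_num) (by norm_num) (by norm_num))
  simp only [smul_eq_mul] at h
  rw [norm_sub_rev y x]
  nlinarith

theorem lipschitzOnWith_objective {N d : ℕ} {f : Fin N → EuclideanSpace ℝ (Fin d) → ℝ}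
    {X : Set (EuclideanSpace ℝ (Fin d))} {L : NNReal} (hf : ∀ i, LipschitzOnWith L (f i) X)
    {x y : EuclideanSpace ℝ (Fin d)} (hx : x ∈ X) (hy : y ∈ X) :
    objective f y - objective f x ≤ L * ‖y - x‖ := by
  rcases Nat.eq_zero_or_pos N with rfl | hN
  · simp only [objective, Finset.univ_eq_empty, Finset.sum_empty, mul_zero, sub_self]
    positivity
  have hN' : (0 : ℝ) < N := by exact_mod_cast hN
  unfold objective
  rw [← mul_sub, ← Finset.sum_sub_distrib]
  have h : ∑ i, (f i y - f i x) ≤ ∑ _i : Fin N, L * ‖y - x‖ := by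
    refine Finset.sum_le_sum fun i _ => (le_abs_self _).trans ?_
    have := (hf i).dist_le_mul y hy x hx
    rwa [Real.dist_eq, dist_eq_norm] at this
  simp only [Finset.sum_const, Finset.card_univ, Fintype.card_fin, nsmul_eq_mul] at h
  calc 1 / (N : ℝ) * ∑ i, (f i y - f i x) ≤ 1 / (N : ℝ) * (N * (L * ‖y - x‖)) := by gcongr
    _ = L * ‖y - x‖ := by field_simp

/-- The feasible set of a strongly convex Lipschitz problem is bounded. -/
theorem norm_sub_minimizer_le {N d : ℕ} {f : Fin N → EuclideanSpace ℝ (Fin d) → ℝ}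
    {X : Set (EuclideanSpace ℝ (Fin d))} {L : NNReal} (hf : ∀ i, LipschitzOnWith L (f i) X)
    {μ : ℝ} (hμ : 0 < μ) (hs : StrongConvexOn X μ (objective f))
    {x y : EuclideanSpace ℝ (Fin d)} (hx : x ∈ X) (hmin : IsMinOn (objective f) X x)
    (hy : y ∈ X) : ‖y - x‖ ≤ 4 * L / μ := by
  -- With `r = ‖y - x‖`, the two bounds read `μ/4 * r² ≤ L * r`.
  have h1 := quadratic_growth hs hx hy hmin
  have h2 := lipschitzOnWith_objective hf hx hy
  rw [le_div_iff₀ hμ]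
  rcases (norm_nonneg (y - x)).eq_or_lt with h0 | h0
  · rw [← h0]; simp
  · have : ‖y - x‖ * (μ * ‖y - x‖) ≤ ‖y - x‖ * (4 * L) := by nlinarith
    have := le_of_mul_le_mul_left this h0
    linarith

/-- The subgradients of a convex function are bounded on bounded sets. -/
theorem exists_subgradient_bound {d : ℕ} {f : EuclideanSpace ℝ (Fin d) → ℝ}
    (hf : ConvexOn ℝ Set.univ f) (w : EuclideanSpace ℝ (Fin d)) (r : ℝ) :
    ∃ G, ∀ x, ‖x - w‖ ≤ r → ∀ g ∈ subdifferential f x, ‖g‖ ≤ G := by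
  have hc : Continuous f := continuousOn_univ.1 (hf.continuousOn isOpen_univ)
  obtain ⟨M, hM⟩ := (isCompact_closedBall w (r + 1)).exists_bound_of_continuousOn hc.continuousOn
  refine ⟨2 * M, fun x hx g hg => ?_⟩
  have hM0 : 0 ≤ M := (norm_nonneg _).trans (hM x (by
    rw [Metric.mem_closedBall, dist_eq_norm]; linarith))
  rcases eq_or_ne g 0 with rfl | hg0
  · simpa using hM0
  have hn : 0 < ‖g‖ := norm_pos_iff.2 hg0
  -- Testing at a unit step along `g` gives `‖g‖ ≤ f (x + g/‖g‖) - f x ≤ 2M`; the radius `r + 1`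
  -- leaves room for the step.
  have h := hg (x + ‖g‖⁻¹ • g)
  have e : inner ℝ g (x + ‖g‖⁻¹ • g - x) = ‖g‖ := by
    rw [add_sub_cancel_left, inner_smul_right, real_inner_self_eq_norm_sq]
    field_simp
  rw [e] at h
  have h1 := hM x (by rw [Metric.mem_closedBall, dist_eq_norm]; linarith)
  have h2 := hM (x + ‖g‖⁻¹ • g) (by
    rw [Metric.mem_closedBall, dist_eq_norm]
    calc ‖x + ‖g‖⁻¹ • g - w‖ = ‖(x - w) + ‖g‖⁻¹ • g‖ := by congr 1; abel
      _ ≤ ‖x - w‖ + ‖‖g‖⁻¹ • g‖ := norm_add_le _ _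
      _ ≤ r + 1 := by
        rw [norm_smul, norm_inv, norm_norm, inv_mul_cancel₀ hn.ne']; linarith)
  rw [Real.norm_eq_abs] at h1 h2
  linarith [neg_abs_le (f x), le_abs_self (f (x + ‖g‖⁻¹ • g))]

/-! ### Disagreement on the network and a Poincaré inequality -/

section Network

variable {ι F : Type*} [Fintype ι] [NormedAddCommGroup F]

/-- The disagreement `∑ᵢⱼ aᵢⱼ ‖xᵢ - xⱼ‖²` across the links. -/
def dirichletEnergy (A : Matrix ι ι ℝ) (x : ι → F) : ℝ := ∑ i, ∑ j, A i j * ‖x i - x j‖ ^ 2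

theorem dirichletEnergy_nonneg {A : Matrix ι ι ℝ} (hA : ∀ i j, 0 ≤ A i j) (x : ι → F) :
    0 ≤ dirichletEnergy A x :=
  Finset.sum_nonneg fun i _ => Finset.sum_nonneg fun j _ => mul_nonneg (hA i j) (sq_nonneg _)

/-- Adding the sum to its copy with `i` and `j` swapped, which symmetry of `A` permits, cancels `w`.
Thus to first order consensus lowers the squared distance to every point by the same energy. -/
theorem sum_inner_laplacian [InnerProductSpace ℝ F] {A : Matrix ι ι ℝ} (hA : A.IsSymm) (x : ι → F) (w : F) :
    2 * ∑ i, inner ℝ (x i - w) (∑ j, A i j • (x j - x i)) = - dirichletEnergy A x := by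
  have h1 : ∑ i, inner ℝ (x i - w) (∑ j, A i j • (x j - x i))
      = ∑ i, ∑ j, A i j * inner ℝ (x i - w) (x j - x i) := by
    simp only [inner_sum, inner_smul_right]
  have h2 : ∑ i, ∑ j, A i j * inner ℝ (x i - w) (x j - x i)
      = ∑ i, ∑ j, A i j * inner ℝ (x j - w) (x i - x j) := by
    rw [Finset.sum_comm]
    refine Finset.sum_congr rfl fun i _ => Finset.sum_congr rfl fun j _ => ?_
    rw [hA.apply i j]
  rw [two_mul, h1]
  nth_rewrite 2 [h2]
  unfold dirichletEnergy
  simp only [← Finset.sum_add_distrib, ← Finset.sum_neg_distrib]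
  refine Finset.sum_congr rfl fun i _ => Finset.sum_congr rfl fun j _ => ?_
  have e : x j - x i = -(x i - x j) := by abel
  have e2 : ‖x i - x j‖ ^ 2 = inner ℝ ((x i - w) - (x j - w)) (x i - x j) := by
    rw [sub_sub_sub_cancel_right, real_inner_self_eq_norm_sq]
  rw [e2, e, inner_neg_right, inner_sub_left (x i - w)]
  ring

/-- Along a connected network, disagreement across links controls all disagreement. -/
theorem exists_poincare_pair {A : Matrix ι ι ℝ} (hA : A.IsIrreducible) (i j : ι) :
    ∃ κ : ℝ, 0 ≤ κ ∧ ∀ x : ι → F, ‖x i - x j‖ ^ 2 ≤ κ * dirichletEnergy A x := by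
  let _ : Quiver ι := A.toQuiver
  obtain ⟨p, -⟩ := hA.connected i j
  -- Along a path, each further edge of weight `a` turns `κ` into `2κ + 2/a`, by `(s + t)² ≤ 2s² +
  -- 2t²`.
  induction p with
  | nil => exact ⟨0, le_rfl, fun x => by simp⟩
  | @cons b c p e ih =>
    obtain ⟨κ, hκ, h⟩ := ih
    have hbc : 0 < A b c := e.down
    refine ⟨2 * κ + 2 * (A b c)⁻¹, by positivity, fun x => ?_⟩
    have h1 : A b c * ‖x b - x c‖ ^ 2 ≤ dirichletEnergy A x :=
      (Finset.single_le_sum (f := fun k => A b k * ‖x b - x k‖ ^ 2)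
        (fun k _ => mul_nonneg (hA.nonneg b k) (sq_nonneg _)) (Finset.mem_univ c)).trans
      (Finset.single_le_sum (f := fun l => ∑ k, A l k * ‖x l - x k‖ ^ 2)
        (fun l _ => Finset.sum_nonneg fun k _ => mul_nonneg (hA.nonneg l k) (sq_nonneg _))
        (Finset.mem_univ b))
    have h2 : ‖x b - x c‖ ^ 2 ≤ (A b c)⁻¹ * dirichletEnergy A x := by
      rwa [← div_eq_inv_mul, le_div_iff₀' hbc]
    have h3 : ‖x i - x c‖ ≤ ‖x i - x b‖ + ‖x b - x c‖ := norm_sub_le_norm_sub_add_norm_sub _ _ _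
    nlinarith [h x, norm_nonneg (x i - x c), sq_nonneg (‖x i - x b‖ - ‖x b - x c‖)]

/-- Sums the pairwise bounds. Deviations are taken from one agent, so that the comparison point is
an actual iterate. The `+ 1` in the witness makes `κ` positive, since it is later divided by. -/
theorem exists_poincare {A : Matrix ι ι ℝ} (hA : A.IsIrreducible) (i : ι) :
    ∃ κ : ℝ, 0 < κ ∧ ∀ x : ι → F, ∑ j, ‖x j - x i‖ ^ 2 ≤ κ * dirichletEnergy A x := by
  choose κ h0 h using fun j => exists_poincare_pair (F := F) hA j i
  refine ⟨∑ j, κ j + 1, by have := Finset.sum_nonneg fun j (_ : j ∈ Finset.univ) => h0 j; linarith,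
    fun x => ?_⟩
  rw [add_mul, Finset.sum_mul]
  have := Finset.sum_le_sum fun j (_ : j ∈ Finset.univ) => h j x
  have := dirichletEnergy_nonneg hA.nonneg x
  linarith

end Network

/-! ### The descent inequality for one round -/

theorem norm_sum_smul_le {ι F : Type*} [Fintype ι] [NormedAddCommGroup F] [NormedSpace ℝ F]
    {a : ι → ℝ} (ha : ∀ j, 0 ≤ a j) (h1 : ∑ j, a j = 1) {v : ι → F} {r : ℝ}
    (hv : ∀ j, ‖v j‖ ≤ r) : ‖∑ j, a j • v j‖ ≤ r := by
  calc ‖∑ j, a j • v j‖ ≤ ∑ j, ‖a j • v j‖ := norm_sum_le _ _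
    _ ≤ ∑ j, a j * r := Finset.sum_le_sum fun j _ => by
      rw [norm_smul, Real.norm_of_nonneg (ha j)]
      exact mul_le_mul_of_nonneg_left (hv j) (ha j)
    _ = r := by rw [← Finset.sum_mul, h1, one_mul]

/-- Separates consensus drift from quantization noise. Weights off the neighbourhood vanish, and the
rows sum to one. -/
theorem mix_eq {N d : ℕ} {E : Set (Fin N × Fin N)} {A : Matrix (Fin N) (Fin N) ℝ}
    (hA : IsNetworkMatrix E A) (β : ℝ) (x q : Fin N → EuclideanSpace ℝ (Fin d)) (i : Fin N) :
    mix E A β x q i = x i + β • ∑ j, A i j • (x j - x i) + β • ∑ j, A i j • (q j - x j) := by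
  have h0 : ∑ j ∈ neighbors E i, A i j • q j = ∑ j, A i j • q j := by
    refine Finset.sum_subset (Finset.subset_univ _) fun j _ hj => ?_
    have hE : (i, j) ∉ E := fun h => hj (by simp [neighbors, h])
    rw [le_antisymm (not_lt.1 (mt (hA.pos_iff i j).1 hE)) (hA.irreducible.nonneg i j), zero_smul]
  have h1 : ∑ j, A i j • x i = x i := by
    rw [← Finset.sum_smul, sum_row_of_mem_doublyStochastic hA.doubly_stochastic, one_smul]
  unfold mix
  rw [h0]
  simp only [smul_sub, Finset.sum_sub_distrib, h1, sub_smul, one_smul]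
  abel

/-- Disagreement `D` contracts at rate `β` and the optimality gap `U` at rate `α`; hence their
combination `V` contracts at the slower of the two rates. -/
theorem min_mul_min_mul_le {κ μ α β D U V : ℝ} (hκ : 0 < κ) (hμ : 0 < μ) (hα : 0 < α)
    (hβ : 0 < β) (hD : 0 ≤ D) (hU : 0 ≤ U) (hV : V ≤ 2 * D + 2 * U) :
    min (1 / (4 * κ)) (μ / 4) * (min α β * V) ≤ β / (2 * κ) * D + 2 * α * (μ / 4 * U) := by
  have hm : 0 < min α β := lt_min hα hβ
  have hc : 0 < min (1 / (4 * κ)) (μ / 4) := by positivity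
  have h1 : min (1 / (4 * κ)) (μ / 4) * min α β ≤ 1 / (4 * κ) * β :=
    mul_le_mul (min_le_left _ _) (min_le_right _ _) hm.le (by positivity)
  have h2 : min (1 / (4 * κ)) (μ / 4) * min α β ≤ μ / 4 * α :=
    mul_le_mul (min_le_right _ _) (min_le_left _ _) hm.le (by positivity)
  have h3 := mul_le_mul_of_nonneg_right h1 hD
  have h4 := mul_le_mul_of_nonneg_right h2 hU
  have h5 := mul_le_mul_of_nonneg_left hV (mul_pos hc hm).le
  have h6 : β / (2 * κ) * D = 2 * (1 / (4 * κ) * β * D) := by field_simp; ring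
  rw [h6]
  linarith

theorem sum_norm_sub_sq_le {ι F : Type*} [Fintype ι] [NormedAddCommGroup F]
    (x : ι → F) (y w : F) :
    ∑ i, ‖x i - w‖ ^ 2 ≤ 2 * ∑ i, ‖x i - y‖ ^ 2 + 2 * (Fintype.card ι * ‖y - w‖ ^ 2) := by
  have : ∑ i, ‖x i - w‖ ^ 2 ≤ ∑ i, (2 * ‖x i - y‖ ^ 2 + 2 * ‖y - w‖ ^ 2) := by
    refine Finset.sum_le_sum fun i _ => ?_
    have := norm_sub_le_norm_sub_add_norm_sub (x i) y w
    nlinarith [norm_nonneg (x i - w), sq_nonneg (‖x i - y‖ - ‖y - w‖)]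
  rw [Finset.sum_add_distrib, ← Finset.mul_sum] at this
  simp only [Finset.sum_const, Finset.card_univ, nsmul_eq_mul] at this
  linarith

/-- The first-order terms are kept exactly, since they carry the contraction and the mean-zero
noise; only the square of the displacement is estimated. -/
theorem norm_add_sq_le_of_bounds {F : Type*} [NormedAddCommGroup F] [InnerProductSpace ℝ F]
    {α β R Q G : ℝ} (hα : 0 ≤ α) (hβ : 0 ≤ β) {u a n g : F} (ha : ‖a‖ ≤ R) (hn : ‖n‖ ≤ Q)
    (hg : ‖g‖ ≤ G) :
    ‖u + β • a + β • n - α • g‖ ^ 2 ≤ ‖u‖ ^ 2 + 2 * β * inner ℝ u a + 2 * β * inner ℝ u n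
      - 2 * α * inner ℝ u g + (2 * (R + Q) ^ 2 * β ^ 2 + 2 * G ^ 2 * α ^ 2) := by
  have e : u + β • a + β • n - α • g = u + (β • (a + n) - α • g) := by
    rw [smul_add]; abel
  have h : ‖β • (a + n) - α • g‖ ≤ β * (R + Q) + α * G := by
    refine (norm_sub_le _ _).trans ?_
    rw [norm_smul, norm_smul, Real.norm_of_nonneg hα, Real.norm_of_nonneg hβ]
    have := (norm_add_le a n).trans (add_le_add ha hn)
    gcongr
  have h2 : ‖β • (a + n) - α • g‖ ^ 2 ≤ (β * (R + Q) + α * G) ^ 2 :=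
    pow_le_pow_left₀ (norm_nonneg _) h 2
  rw [e, norm_add_sq_real, inner_sub_right, inner_smul_right, inner_smul_right, inner_add_right]
  nlinarith [sq_nonneg (β * (R + Q) - α * G)]

/-- The agents evaluate subgradients at different points. Moving each `f i` to the common point `y`
costs `L * ‖x i - y‖`, after which quadratic growth of the average applies. -/
theorem sum_inner_subgradient_ge {N d : ℕ} {f : Fin N → EuclideanSpace ℝ (Fin d) → ℝ}
    {X : Set (EuclideanSpace ℝ (Fin d))} {L : NNReal} (hf : ∀ i, LipschitzOnWith L (f i) X)
    {μ : ℝ} (hs : StrongConvexOn X μ (objective f))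
    {w y : EuclideanSpace ℝ (Fin d)} (hw : w ∈ X) (hmin : IsMinOn (objective f) X w)
    (hy : y ∈ X) {x g : Fin N → EuclideanSpace ℝ (Fin d)} (hx : ∀ i, x i ∈ X)
    (hg : ∀ i, g i ∈ subdifferential (f i) (x i)) :
    N * (μ / 4 * ‖y - w‖ ^ 2) - L * ∑ i, ‖x i - y‖ ≤ ∑ i, inner ℝ (x i - w) (g i) := by
  rcases Nat.eq_zero_or_pos N with rfl | hN
  · simp
  have hN' : (0 : ℝ) < N := by exact_mod_cast hN
  have h1 : ∑ i, (f i y - f i w - L * ‖x i - y‖) ≤ ∑ i, inner ℝ (x i - w) (g i) := by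
    refine Finset.sum_le_sum fun i _ => ?_
    have h := hg i w
    rw [real_inner_comm, ← neg_sub (x i) w, inner_neg_left] at h
    have h' := (hf i).dist_le_mul (x i) (hx i) y hy
    rw [Real.dist_eq, dist_eq_norm] at h'
    linarith [neg_abs_le (f i (x i) - f i y)]
  have h2 : N * (objective f y - objective f w) = ∑ i, (f i y - f i w) := by
    unfold objective
    rw [Finset.sum_sub_distrib]
    field_simp
  have h3 := mul_le_mul_of_nonneg_left (quadratic_growth hs hw hy hmin) hN'.le
  rw [Finset.sum_sub_distrib, ← Finset.mul_sum] at h1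
  linarith

/-- One round of the method: the summed squared distance to the minimizer decreases, up to a
summable error and a noise term that is linear in the quantization errors. -/
theorem one_step {N d : ℕ} {f : Fin N → EuclideanSpace ℝ (Fin d) → ℝ}
    {X : Set (EuclideanSpace ℝ (Fin d))} (hX : Convex ℝ X) {L : NNReal}
    (hf : ∀ i, LipschitzOnWith L (f i) X) {μ : ℝ} (hμ : 0 < μ)
    (hs : StrongConvexOn X μ (objective f))
    {w : EuclideanSpace ℝ (Fin d)} (hw : w ∈ X) (hmin : IsMinOn (objective f) X w)
    {E : Set (Fin N × Fin N)} {A : Matrix (Fin N) (Fin N) ℝ} (hA : IsNetworkMatrix E A)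
    (i₀ : Fin N) (R Q G B : ℝ) :
    ∃ c K : ℝ, 0 < c ∧ 0 ≤ K ∧ ∀ (α β : ℝ) (x g q x' : Fin N → EuclideanSpace ℝ (Fin d)),
      0 < α → 0 < β → β ≤ B → (∀ i, x i ∈ X) → (∀ i j, ‖x j - x i‖ ≤ R) →
      (∀ i, ‖q i - x i‖ ≤ Q) → (∀ i, ‖g i‖ ≤ G) → (∀ i, g i ∈ subdifferential (f i) (x i)) →
      (∀ i, IsProjection X (mix E A β x q i - α • g i) (x' i)) →
      ∑ i, ‖x' i - w‖ ^ 2 ≤ ∑ i, ‖x i - w‖ ^ 2 - c * (min α β * ∑ i, ‖x i - w‖ ^ 2)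
        + K * (α ^ 2 / β + β ^ 2)
        + 2 * β * ∑ i, ∑ j, A i j * inner ℝ (x i - w) (q j - x j) := by
  obtain ⟨κ, hκ, hP⟩ := exists_poincare (F := EuclideanSpace ℝ (Fin d)) hA.irreducible i₀
  have hN : (0 : ℝ) < N := by exact_mod_cast i₀.pos
  -- `max B 0` converts `α²` into a multiple of `α²/β`, and keeps `K` nonnegative for every `B`.
  refine ⟨min (1 / (4 * κ)) (μ / 4),
    N * (2 * (R + Q) ^ 2 + 2 * G ^ 2 * max B 0 + 2 * κ * L ^ 2), by positivity, by positivity, ?_⟩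
  intro α β x g q x' hα hβ hB hx hR hQ hG hg hx'
  have hrow := fun i => sum_row_of_mem_doublyStochastic hA.doubly_stochastic i
  have hA0 := hA.irreducible.nonneg
  have h1 : ∑ i, ‖x' i - w‖ ^ 2 ≤ ∑ i, (‖x i - w‖ ^ 2
      + 2 * β * inner ℝ (x i - w) (∑ j, A i j • (x j - x i))
      + 2 * β * inner ℝ (x i - w) (∑ j, A i j • (q j - x j))
      - 2 * α * inner ℝ (x i - w) (g i) + (2 * (R + Q) ^ 2 * β ^ 2 + 2 * G ^ 2 * α ^ 2)) := by
    refine Finset.sum_le_sum fun i _ => ((hx' i).norm_sub_le hX hw).trans ?_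
    refine le_trans (le_of_eq ?_) (norm_add_sq_le_of_bounds hα.le hβ.le
      (norm_sum_smul_le (hA0 i) (hrow i) (hR i)) (norm_sum_smul_le (hA0 i) (hrow i) hQ) (hG i))
    rw [mix_eq hA]
    congr 2
    abel
  simp only [Finset.sum_add_distrib, Finset.sum_sub_distrib, ← Finset.mul_sum, Finset.sum_const,
    Finset.card_univ, Fintype.card_fin, nsmul_eq_mul] at h1
  have hnoise : ∑ i, inner ℝ (x i - w) (∑ j, A i j • (q j - x j))
      = ∑ i, ∑ j, A i j * inner ℝ (x i - w) (q j - x j) := by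
    simp only [inner_sum, inner_smul_right]
  rw [hnoise] at h1
  have h2 := sum_inner_laplacian hA.symmetric x w
  have h3 := sum_inner_subgradient_ge hf hs hw hmin (hx i₀) hx hg
  have h4 := hP x
  have h5 := sum_norm_sub_sq_le x (x i₀) w
  rw [Fintype.card_fin] at h5
  -- Young's inequality, the source of `α²/β`: half of the consensus gain `β * D / κ` pays for the
  -- disagreement error, and the other half remains for the contraction.
  have h6 : 2 * α * (L * ∑ i, ‖x i - x i₀‖)
      ≤ β / (2 * κ) * ∑ i, ‖x i - x i₀‖ ^ 2 + N * (2 * κ * L ^ 2 * (α ^ 2 / β)) := by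
    have : ∑ i, 2 * α * (L * ‖x i - x i₀‖)
        ≤ ∑ i, (β / (2 * κ) * ‖x i - x i₀‖ ^ 2 + 2 * κ * L ^ 2 * (α ^ 2 / β)) := by
      refine Finset.sum_le_sum fun i _ => ?_
      rw [← sub_nonneg]
      have e : β / (2 * κ) * ‖x i - x i₀‖ ^ 2 + 2 * κ * L ^ 2 * (α ^ 2 / β)
          - 2 * α * (L * ‖x i - x i₀‖)
          = (β * ‖x i - x i₀‖ - 2 * κ * L * α) ^ 2 / (2 * κ * β) := by
        field_simp
        ring
      rw [e]
      positivity
    simp only [Finset.sum_add_distrib, ← Finset.mul_sum, Finset.sum_const,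
      Finset.card_univ, Fintype.card_fin, nsmul_eq_mul] at this
    linarith
  have h7 : α ^ 2 ≤ max B 0 * (α ^ 2 / β) := by
    rw [mul_div_assoc', le_div_iff₀ hβ, mul_comm]
    have : β ≤ max B 0 := hB.trans (le_max_left _ _)
    gcongr
  set V := ∑ i, ‖x i - w‖ ^ 2
  set D := ∑ i, ‖x i - x i₀‖ ^ 2
  set S := dirichletEnergy A x
  set I := ∑ i, inner ℝ (x i - w) (∑ j, A i j • (x j - x i))
  set J := ∑ i, inner ℝ (x i - w) (g i)
  set Z := ∑ i, ∑ j, A i j * inner ℝ (x i - w) (q j - x j)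
  set T := ∑ i, ‖x i - x i₀‖
  set U := ‖x i₀ - w‖ ^ 2
  have hD : 0 ≤ D := Finset.sum_nonneg fun _ _ => sq_nonneg _
  have hU : 0 ≤ U := sq_nonneg _
  have h8 : β * (D / κ) ≤ β * S := by
    refine mul_le_mul_of_nonneg_left ?_ hβ.le
    rwa [div_le_iff₀' hκ]
  have h9 : 2 * α * (N * (μ / 4 * U) - L * T) ≤ 2 * α * J :=
    mul_le_mul_of_nonneg_left h3 (by positivity)
  have h10 : min (1 / (4 * κ)) (μ / 4) * (min α β * V)
      ≤ β / (2 * κ) * D + 2 * α * (N * (μ / 4 * U)) := by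
    have := min_mul_min_mul_le hκ hμ hα hβ hD (mul_nonneg hN.le hU) h5
    linarith
  have h11 : N * (2 * G ^ 2 * α ^ 2) ≤ N * (2 * G ^ 2 * (max B 0 * (α ^ 2 / β))) := by gcongr
  -- One constant `K` serves both error terms; `h12` and `h13` are the surplus.
  have h12 : 0 ≤ N * (2 * G ^ 2 * max B 0 + 2 * κ * L ^ 2) * β ^ 2 := by positivity
  have h13 : 0 ≤ N * (2 * (R + Q) ^ 2) * (α ^ 2 / β) := by positivity
  have h14 : β * (2 * I) = - (β * S) := by rw [h2]; ring
  have h15 : β * (D / κ) = 2 * (β / (2 * κ) * D) := by field_simp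
  linarith

/-! ### Random quantization: two-point support and unbiasedness -/

section Quantization

theorem measurable_quantLower (b : ℕ) : Measurable (quantLower b) :=
  ((measurable_from_top (f := fun n : ℤ => (n : ℝ))).comp
    (Int.measurable_floor.comp (measurable_id.const_mul _))).div_const _

theorem measurable_quantUpper (b : ℕ) : Measurable (quantUpper b) :=
  (measurable_quantLower b).add_const _

theorem quantLower_le (b : ℕ) (x : ℝ) : quantLower b x ≤ x := by
  rw [quantLower, div_le_iff₀' (by positivity)]
  exact Int.floor_le _

theorem lt_quantUpper (b : ℕ) (x : ℝ) : x < quantUpper b x := by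
  rw [quantUpper, quantLower, ← add_div, lt_div_iff₀' (by positivity)]
  exact Int.lt_floor_add_one _

theorem two_pow_mul_quantUpper_sub (b : ℕ) (x : ℝ) :
    2 ^ b * (quantUpper b x - quantLower b x) = 1 := by
  rw [quantUpper, add_sub_cancel_left]
  field_simp

theorem quantUpper_sub_quantLower_le (b : ℕ) (x : ℝ) :
    quantUpper b x - quantLower b x ≤ 1 := by
  rw [quantUpper, add_sub_cancel_left]
  exact div_le_one_of_le₀ (one_le_pow₀ one_le_two) (by positivity)

variable {Ω : Type*} {m mΩ : MeasurableSpace Ω} {P : Measure Ω} [IsProbabilityMeasure P]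
  {b : ℕ} {x q : Ω → ℝ}

theorem measurableSet_eq_quantUpper (hx : Measurable x) (hq : Measurable q) :
    MeasurableSet {ω | q ω = quantUpper b (x ω)} :=
  measurableSet_eq_fun hq ((measurable_quantUpper b).comp hx)

theorem measurableSet_eq_quantLower (hx : Measurable x) (hq : Measurable q) :
    MeasurableSet {ω | q ω = quantLower b (x ω)} :=
  measurableSet_eq_fun hq ((measurable_quantLower b).comp hx)

/-- A random quantization takes only the two neighbouring grid points as values. -/
theorem IsRandomQuantization.ae_eq (hm : m ≤ mΩ) (h : IsRandomQuantization P m b x q)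
    (hx : Measurable x) (hq : Measurable q) :
    ∀ᵐ ω ∂P, q ω = quantUpper b (x ω) ∨ q ω = quantLower b (x ω) := by
  set U := {ω | q ω = quantUpper b (x ω)} with hU
  set W := {ω | q ω = quantLower b (x ω)} with hW
  have mU : MeasurableSet U := measurableSet_eq_quantUpper hx hq
  have mW : MeasurableSet W := measurableSet_eq_quantLower hx hq
  have iU : Integrable (U.indicator fun _ => (1 : ℝ)) P := (integrable_const 1).indicator mU
  have iW : Integrable (W.indicator fun _ => (1 : ℝ)) P := (integrable_const 1).indicator mW
  -- The two conditional probabilities add up to `2^b` times the grid width, which is 1, so these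
  -- disjoint events exhaust the space.
  have hadd : P[U.indicator (fun _ => (1 : ℝ)) + W.indicator (fun _ => (1 : ℝ)) | m]
      =ᵐ[P] fun _ => (1 : ℝ) := by
    filter_upwards [condExp_add iU iW m, h.1, h.2] with ω h1 h2 h3
    rw [h1, Pi.add_apply, h2, h3, ← two_pow_mul_quantUpper_sub b (x ω)]
    ring
  have hint : P.real U + P.real W = 1 := by
    have := integral_congr_ae hadd
    rw [integral_condExp hm, integral_add' iU iW, integral_indicator_const _ mU,
      integral_indicator_const _ mW] at this
    simpa using this
  have hdisj : Disjoint U W := by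
    rw [Set.disjoint_left]
    intro ω h1 h2
    have h1 : q ω = quantUpper b (x ω) := h1
    have h2 : q ω = quantLower b (x ω) := h2
    linarith [quantLower_le b (x ω), lt_quantUpper b (x ω)]
  have : P.real (U ∪ W) = 1 := by rw [measureReal_union hdisj mW, hint]
  have h1 : P (U ∪ W) = 1 := by
    rw [measureReal_def] at this
    exact (ENNReal.toReal_eq_one_iff _).1 this
  exact (mem_ae_iff_prob_eq_one (mU.union mW)).2 h1

theorem IsRandomQuantization.abs_sub_le (hm : m ≤ mΩ) (h : IsRandomQuantization P m b x q)
    (hx : Measurable x) (hq : Measurable q) : ∀ᵐ ω ∂P, |q ω - x ω| ≤ 1 := by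
  filter_upwards [h.ae_eq hm hx hq] with ω hω
  have h1 := quantLower_le b (x ω)
  have h2 := lt_quantUpper b (x ω)
  have h3 := quantUpper_sub_quantLower_le b (x ω)
  rw [abs_le]
  rcases hω with h | h <;> rw [h] <;> constructor <;> linarith

/-- A random quantization is unbiased. -/
theorem IsRandomQuantization.condExp_sub (hm : m ≤ mΩ) (h : IsRandomQuantization P m b x q)
    (hx : Measurable[m] x) (hq : Measurable q) : P[fun ω => q ω - x ω | m] =ᵐ[P] 0 := by
  have hx' : Measurable x := hx.mono hm le_rfl
  set U := {ω | q ω = quantUpper b (x ω)} with hU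
  set W := {ω | q ω = quantLower b (x ω)} with hW
  have mU : MeasurableSet U := measurableSet_eq_quantUpper hx' hq
  have mW : MeasurableSet W := measurableSet_eq_quantLower hx' hq
  have iU : Integrable (U.indicator fun _ => (1 : ℝ)) P := (integrable_const 1).indicator mU
  have iW : Integrable (W.indicator fun _ => (1 : ℝ)) P := (integrable_const 1).indicator mW
  let u : Ω → ℝ := fun ω => quantUpper b (x ω) - x ω
  let l : Ω → ℝ := fun ω => quantLower b (x ω) - x ω
  have hu : Measurable[m] u := ((measurable_quantUpper b).comp hx).sub hx
  have hl : Measurable[m] l := ((measurable_quantLower b).comp hx).sub hx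
  have bu : ∀ ω, ‖u ω‖ ≤ 1 := fun ω => by
    rw [Real.norm_eq_abs, abs_le]
    have h1 := quantLower_le b (x ω)
    have h2 := lt_quantUpper b (x ω)
    have h3 := quantUpper_sub_quantLower_le b (x ω)
    constructor <;> simp only [u] <;> linarith
  have bl : ∀ ω, ‖l ω‖ ≤ 1 := fun ω => by
    rw [Real.norm_eq_abs, abs_le]
    have h1 := quantLower_le b (x ω)
    have h2 := lt_quantUpper b (x ω)
    have h3 := quantUpper_sub_quantLower_le b (x ω)
    constructor <;> simp only [l] <;> linarith
  have cu := condExp_stronglyMeasurable_mul_of_bound hm hu.stronglyMeasurable iU 1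
    (Eventually.of_forall bu)
  have cl := condExp_stronglyMeasurable_mul_of_bound hm hl.stronglyMeasurable iW 1
    (Eventually.of_forall bl)
  have ju : Integrable (u * U.indicator fun _ => (1 : ℝ)) P :=
    iU.bdd_mul (hu.mono hm le_rfl).aestronglyMeasurable (Eventually.of_forall bu)
  have jl : Integrable (l * W.indicator fun _ => (1 : ℝ)) P :=
    iW.bdd_mul (hl.mono hm le_rfl).aestronglyMeasurable (Eventually.of_forall bl)
  -- The factors `u` and `l` are `m`-measurable and come out of the conditional expectation, leaving
  -- `2^b * (u * (-l) + l * u) = 0`.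
  have e : (fun ω => q ω - x ω) =ᵐ[P]
      u * U.indicator (fun _ => (1 : ℝ)) + l * W.indicator (fun _ => (1 : ℝ)) := by
    filter_upwards [h.ae_eq hm hx' hq] with ω hω
    have h1 := quantLower_le b (x ω)
    have h2 := lt_quantUpper b (x ω)
    rcases hω with hω | hω
    · have a1 : ω ∈ U := hω
      have a2 : ω ∉ W := fun h => by
        have h : q ω = quantLower b (x ω) := h
        linarith
      simp [a1, a2, u, hω]
    · have a1 : ω ∈ W := hω
      have a2 : ω ∉ U := fun h => by
        have h : q ω = quantUpper b (x ω) := h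
        linarith
      simp [a1, a2, l, hω]
  filter_upwards [condExp_congr_ae (m := m) e, condExp_add ju jl m, cu, cl, h.1, h.2]
    with ω e1 e2 e3 e4 e5 e6
  rw [e1, e2, Pi.add_apply, e3, e4, Pi.mul_apply, Pi.mul_apply, e5, e6]
  simp only [u, l, Pi.zero_apply]
  ring

theorem IsRandomQuantization.condExp_mul_sub (hm : m ≤ mΩ)
    (h : IsRandomQuantization P m b x q) (hx : Measurable[m] x) (hq : Measurable q)
    {a : Ω → ℝ} (ha : Measurable[m] a) {r : ℝ} (hr : ∀ ω, |a ω| ≤ r) :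
    Integrable (fun ω => a ω * (q ω - x ω)) P ∧
      P[fun ω => a ω * (q ω - x ω) | m] =ᵐ[P] 0 := by
  have hx' : Measurable x := hx.mono hm le_rfl
  have hi : Integrable (fun ω => q ω - x ω) P :=
    Integrable.of_bound (hq.sub hx').aestronglyMeasurable 1 (h.abs_sub_le hm hx' hq)
  refine ⟨hi.bdd_mul (ha.mono hm le_rfl).aestronglyMeasurable (Eventually.of_forall hr), ?_⟩
  filter_upwards [condExp_stronglyMeasurable_mul_of_bound hm ha.stronglyMeasurable hi r
    (Eventually.of_forall hr), h.condExp_sub hm hx hq] with ω h1 h2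
  change (P[a * (fun ω => q ω - x ω) | m]) ω = _
  rw [h1, Pi.mul_apply, h2, Pi.zero_apply, mul_zero]

end Quantization

/-- The noise that the quantization errors contribute to one round has conditional mean zero. -/
theorem condExp_noise {Ω : Type*} {m mΩ : MeasurableSpace Ω} {P : Measure Ω}
    [IsProbabilityMeasure P] (hm : m ≤ mΩ) {N d b : ℕ} (A : Matrix (Fin N) (Fin N) ℝ)
    {x q : Fin N → Ω → EuclideanSpace ℝ (Fin d)} (w : EuclideanSpace ℝ (Fin d))
    (hx : ∀ i, Measurable[m] (x i)) (hq : ∀ i, Measurable (q i))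
    (hQ : ∀ i c, IsRandomQuantization P m b (fun ω => x i ω c) (fun ω => q i ω c))
    {r : ℝ} (hr : ∀ i ω, ‖x i ω - w‖ ≤ r) :
    Integrable (fun ω => ∑ i, ∑ j, A i j * inner ℝ (x i ω - w) (q j ω - x j ω)) P ∧
      P[fun ω => ∑ i, ∑ j, A i j * inner ℝ (x i ω - w) (q j ω - x j ω) | m] =ᵐ[P] 0 := by
  -- In coordinates, every summand is a bounded `m`-measurable factor times one scalar error. By
  -- linearity, no independence between coordinates or agents is needed.
  let a : Fin N × Fin N × Fin d → Ω → ℝ := fun p ω => A p.1 p.2.1 * (x p.1 ω p.2.2 - w p.2.2)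
  let ξ : Fin N × Fin N × Fin d → Ω → ℝ := fun p ω =>
    a p ω * (q p.2.1 ω p.2.2 - x p.2.1 ω p.2.2)
  have hcoord : ∀ (c : Fin d), Measurable fun v : EuclideanSpace ℝ (Fin d) => v c := fun c => by
    fun_prop
  have ha : ∀ p, Measurable[m] (a p) := fun p =>
    Measurable.const_mul (Measurable.sub_const ((hcoord p.2.2).comp (hx p.1)) (w p.2.2)) (A p.1 p.2.1)
  have key : ∀ p, Integrable (ξ p) P ∧ P[ξ p | m] =ᵐ[P] 0 := fun p => by
    refine (hQ p.2.1 p.2.2).condExp_mul_sub hm ((hcoord _).comp (hx _)) ((hcoord _).comp (hq _))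
      (ha p) (r := |A p.1 p.2.1| * r) fun ω => ?_
    rw [abs_mul]
    refine mul_le_mul_of_nonneg_left ?_ (abs_nonneg _)
    exact (PiLp.norm_apply_le (x p.1 ω - w) p.2.2).trans (hr p.1 ω)
  have e : (fun ω => ∑ i, ∑ j, A i j * inner ℝ (x i ω - w) (q j ω - x j ω)) = ∑ p, ξ p := by
    funext ω
    rw [Finset.sum_apply, Fintype.sum_prod_type]
    refine Finset.sum_congr rfl fun i _ => ?_
    rw [Fintype.sum_prod_type]
    refine Finset.sum_congr rfl fun j _ => ?_
    rw [PiLp.inner_apply, Finset.mul_sum]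
    refine Finset.sum_congr rfl fun c _ => ?_
    simp only [ξ, a, PiLp.sub_apply, RCLike.inner_apply, conj_trivial]
    ring
  rw [e]
  refine ⟨integrable_finsetSum' _ fun p _ => (key p).1, ?_⟩
  refine (condExp_finsetSum (fun p _ => (key p).1) m).trans ?_
  have : ∀ᵐ ω ∂P, ∀ p, (P[ξ p | m]) ω = 0 := ae_all_iff.2 fun p => (key p).2
  filter_upwards [this] with ω hω
  rw [Finset.sum_apply]
  exact Finset.sum_eq_zero fun p _ => hω p

/-! ### Convergence of almost supermartingales -/

/-- If a nonnegative sequence converges after adding its weighted partial sums, and the weights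
are not summable, then the sequence tends to zero. -/
theorem tendsto_zero_of_tendsto_add_sum {v m : ℕ → ℝ} (hv : ∀ k, 0 ≤ v k) (hm : ∀ k, 0 ≤ m k)
    (hsum : ¬ Summable m) {l : ℝ}
    (h : Tendsto (fun k => v k + ∑ j ∈ Finset.range k, m j * v j) atTop (𝓝 l)) :
    Tendsto v atTop (𝓝 0) := by
  have hnn : ∀ j, 0 ≤ m j * v j := fun j => mul_nonneg (hm j) (hv j)
  obtain ⟨M, hM⟩ := h.bddAbove_range
  have hs : Summable fun j => m j * v j :=
    summable_of_sum_range_le (c := M) hnn fun k =>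
      (le_add_of_nonneg_left (hv k)).trans (hM ⟨k, rfl⟩)
  have h2 : Tendsto v atTop (𝓝 (l - ∑' j, m j * v j)) := by
    simpa using h.sub hs.hasSum.tendsto_sum_nat
  set a := l - ∑' j, m j * v j
  have ha : 0 ≤ a := ge_of_tendsto' h2 hv
  -- A limit `a > 0` would give `m k ≤ (2/a) * (m k * v k)` eventually, making `m` summable.
  rcases ha.eq_or_lt with h0 | h0
  · rwa [← h0] at h2
  · exfalso
    refine hsum ?_
    have hev : ∀ᶠ k in atTop, a / 2 < v k := h2.eventually (lt_mem_nhds (by linarith))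
    refine Summable.of_norm_bounded_eventually_nat (g := fun j => 2 / a * (m j * v j))
      (hs.mul_left _) ?_
    filter_upwards [hev] with k hk
    rw [Real.norm_of_nonneg (hm k)]
    calc m k = 2 / a * (m k * (a / 2)) := by field_simp
      _ ≤ 2 / a * (m k * v k) := by
        have := hm k
        gcongr

/-- A bounded nonnegative almost supermartingale with summable errors and non-summable
contraction rates tends to zero almost surely. -/
theorem ae_tendsto_zero_of_condExp_le {Ω : Type*} {mΩ : MeasurableSpace Ω} {P : Measure Ω}
    [IsProbabilityMeasure P] {ℱ : Filtration ℕ mΩ} {V : ℕ → Ω → ℝ} {m ε : ℕ → ℝ} {M : ℝ}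
    (hV : ∀ k, Measurable[ℱ k] (V k)) (hV0 : ∀ k ω, 0 ≤ V k ω) (hVM : ∀ k ω, V k ω ≤ M)
    (hm : ∀ k, 0 ≤ m k) (hsum : ¬ Summable m) (hε0 : ∀ k, 0 ≤ ε k) (hε : Summable ε)
    (h : ∀ k, P[V (k + 1) | ℱ k] ≤ᵐ[P] fun ω => V k ω - m k * V k ω + ε k) :
    ∀ᵐ ω ∂P, Tendsto (fun k => V k ω) atTop (𝓝 0) := by
  have hVi : ∀ k, Integrable (V k) P := fun k =>
    Integrable.of_bound ((hV k).mono (ℱ.le k) le_rfl).aestronglyMeasurable M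
      (Eventually.of_forall fun ω => by rw [Real.norm_of_nonneg (hV0 k ω)]; exact hVM k ω)
  -- Compensating `V` by the accumulated decrease minus the errors yields a supermartingale `W`; `S
  -- (k + 1)` is already known at time `k`.
  let S : ℕ → Ω → ℝ := fun k ω => ∑ j ∈ Finset.range k, (m j * V j ω - ε j)
  let W : ℕ → Ω → ℝ := fun k ω => V k ω + S k ω
  have hSm : ∀ k n, k ≤ n + 1 → Measurable[ℱ n] (S k) := fun k n hk =>
    Finset.measurable_fun_sum _ fun j hj =>
      (((hV j).mono (ℱ.mono (by have := Finset.mem_range.1 hj; omega)) le_rfl).const_mul _).sub_const _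
  have hSi : ∀ k, Integrable (S k) P := fun k =>
    integrable_finsetSum _ fun j _ => ((hVi j).const_mul _).sub (integrable_const _)
  have hWi : ∀ k, Integrable (W k) P := fun k => (hVi k).add (hSi k)
  have hsuper : Supermartingale W ℱ P := by
    refine supermartingale_nat (fun k => ((hV k).add (hSm k k (by omega))).stronglyMeasurable)
      hWi fun k => ?_
    have e : P[S (k + 1) | ℱ k] = S (k + 1) :=
      condExp_of_stronglyMeasurable (ℱ.le k) (hSm _ _ le_rfl).stronglyMeasurable (hSi _)
    filter_upwards [condExp_add (hVi (k + 1)) (hSi (k + 1)) (ℱ k), h k] with ω h1 h2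
    change (P[V (k + 1) + S (k + 1) | ℱ k]) ω ≤ _
    rw [h1, Pi.add_apply, e]
    simp only [W, S, Finset.sum_range_succ]
    linarith
  have hlow : ∀ k ω, - ∑' j, ε j ≤ W k ω := fun k ω => by
    have h1 : ∑ j ∈ Finset.range k, ε j ≤ ∑' j, ε j := hε.sum_le_tsum _ fun j _ => hε0 j
    have h2 : 0 ≤ ∑ j ∈ Finset.range k, m j * V j ω :=
      Finset.sum_nonneg fun j _ => mul_nonneg (hm j) (hV0 j ω)
    simp only [W, S, Finset.sum_sub_distrib]
    linarith [hV0 k ω]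
  set T := ∑' j, ε j
  have hT : 0 ≤ T := tsum_nonneg hε0
  -- Since `W ≥ -T`, one has `|W| ≤ W + 2T`, and the mean of `W` is at most `M`.
  have hbound : ∀ k, eLpNorm ((-W) k) 1 P ≤ (Real.toNNReal (M + 2 * T) : NNReal) := fun k => by
    have h1 : ∫ ω, W k ω ∂P ≤ M := by
      have h2 := hsuper.setIntegral_le (Nat.zero_le k) MeasurableSet.univ
      simp only [setIntegral_univ] at h2
      refine h2.trans ?_
      have : ∀ ω, W 0 ω ≤ M := fun ω => by simpa [W, S] using hVM 0 ω
      calc ∫ ω, W 0 ω ∂P ≤ ∫ _ω, M ∂P := integral_mono (hWi 0) (integrable_const _) this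
        _ = M := by simp
    have h3 : ∫ ω, ‖W k ω‖ ∂P ≤ M + 2 * T := by
      calc ∫ ω, ‖W k ω‖ ∂P ≤ ∫ ω, (W k ω + 2 * T) ∂P := by
            refine integral_mono (hWi k).norm ((hWi k).add (integrable_const _)) fun ω => ?_
            have := hlow k ω
            exact abs_le.2 ⟨by linarith, by linarith⟩
        _ = ∫ ω, W k ω ∂P + 2 * T := by
            rw [integral_add (hWi k) (integrable_const _)]; simp
        _ ≤ _ := by linarith
    rw [Pi.neg_apply, eLpNorm_neg, eLpNorm_one_eq_lintegral_enorm,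
      ← ofReal_integral_norm_eq_lintegral_enorm (hWi k)]
    exact ENNReal.ofReal_le_ofReal h3
  filter_upwards [hsuper.neg.exists_ae_tendsto_of_bdd hbound] with ω hω
  obtain ⟨l, hl⟩ := hω
  refine tendsto_zero_of_tendsto_add_sum (fun k => hV0 k ω) hm hsum (l := - l + T) ?_
  have h4 := hl.neg.add hε.hasSum.tendsto_sum_nat
  refine h4.congr fun k => ?_
  simp only [W, S, Pi.neg_apply, Finset.sum_sub_distrib]
  ring

/-! ### Weighted averages and stepsizes -/

/-- Weighted averages converge to the limit of the averaged sequence if every single weight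
vanishes in the limit. -/
theorem tendsto_weighted_average {F : Type*} [NormedAddCommGroup F] [NormedSpace ℝ F]
    {γ : ℕ → ℕ → ℝ} (h0 : ∀ᶠ k in atTop, ∀ t ≤ k, 0 ≤ γ k t)
    (h1 : ∀ᶠ k in atTop, ∑ t ∈ Finset.range (k + 1), γ k t = 1)
    (hγ : ∀ t, Tendsto (fun k => γ k t) atTop (𝓝 0)) {u : ℕ → F} {l : F}
    (hu : Tendsto u atTop (𝓝 l)) :
    Tendsto (fun k => ∑ t ∈ Finset.range (k + 1), γ k t • u t) atTop (𝓝 l) := by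
  rw [Metric.tendsto_atTop] at hu
  rw [tendsto_iff_norm_sub_tendsto_zero, Metric.tendsto_nhds]
  intro ε hε
  obtain ⟨n, hn⟩ := hu (ε / 2) (by positivity)
  -- Toeplitz argument: the finite head has vanishing weights, and the tail is within `ε / 2` with
  -- total weight at most 1.
  have hhead : Tendsto (fun k => ∑ t ∈ Finset.range n, γ k t * ‖u t - l‖) atTop (𝓝 0) := by
    simpa using tendsto_finsetSum (Finset.range n) fun t _ => (hγ t).mul_const ‖u t - l‖
  filter_upwards [h0, h1, hhead.eventually (gt_mem_nhds (half_pos hε)), eventually_ge_atTop n]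
    with k h0 h1 hk hnk
  rw [dist_zero_right, norm_norm]
  have e : ∑ t ∈ Finset.range (k + 1), γ k t • u t - l
      = ∑ t ∈ Finset.range (k + 1), γ k t • (u t - l) := by
    simp only [smul_sub, Finset.sum_sub_distrib, ← Finset.sum_smul, h1, one_smul]
  have hterm : ∀ t ∈ Finset.range (k + 1), ‖γ k t • (u t - l)‖ = γ k t * ‖u t - l‖ :=
    fun t ht => by
      rw [norm_smul, Real.norm_of_nonneg (h0 t (Nat.lt_succ_iff.1 (Finset.mem_range.1 ht)))]
  rw [e]
  refine (norm_sum_le _ _).trans_lt ?_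
  rw [Finset.sum_congr rfl hterm, ← Finset.sum_range_add_sum_Ico _ (by omega : n ≤ k + 1)]
  have htail : ∑ t ∈ Finset.Ico n (k + 1), γ k t * ‖u t - l‖ ≤ ε / 2 := by
    calc ∑ t ∈ Finset.Ico n (k + 1), γ k t * ‖u t - l‖
        ≤ ∑ t ∈ Finset.Ico n (k + 1), γ k t * (ε / 2) := by
          refine Finset.sum_le_sum fun t ht => ?_
          rw [Finset.mem_Ico] at ht
          refine mul_le_mul_of_nonneg_left ?_ (h0 t (by omega))
          rw [← dist_eq_norm]
          exact (hn t ht.1).le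
      _ ≤ ∑ t ∈ Finset.range (k + 1), γ k t * (ε / 2) := by
          refine Finset.sum_le_sum_of_subset_of_nonneg (fun t ht => ?_) fun t ht _ => ?_
          · rw [Finset.mem_Ico] at ht; exact Finset.mem_range.2 ht.2
          · exact mul_nonneg (h0 t (Nat.lt_succ_iff.1 (Finset.mem_range.1 ht))) (by positivity)
      _ = ε / 2 := by rw [← Finset.sum_mul, h1, one_mul]
  linarith

/-- For fixed `t`, the term `γ_k^t β_t² / α_t` is dominated by the whole nonnegative sum, which
tends to zero. -/
theorem WeightConditions.tendsto_zero {α β : ℕ → ℝ} {μ C : ℝ} {γ : ℕ → ℕ → ℝ}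
    (hγ : WeightConditions α β μ γ) (hs : StepsizeConditions α β C) (t : ℕ) :
    Tendsto (fun k => γ k t) atTop (𝓝 0) := by
  have h := hγ.beta_term.mul_const (α t / β t ^ 2)
  rw [zero_mul] at h
  refine squeeze_zero' ?_ ?_ h
  · filter_upwards [eventually_ge_atTop 1, eventually_ge_atTop t] with k h1 h2
    exact (hγ.pos k t h1 h2).le
  · filter_upwards [eventually_ge_atTop 1, eventually_ge_atTop t] with k h1 h2
    have ha := hs.alpha_pos t
    have hb := hs.beta_pos t
    have : γ k t / α t * β t ^ 2 ≤ ∑ s ∈ Finset.range (k + 1), γ k s / α s * β s ^ 2 :=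
      Finset.single_le_sum (f := fun s => γ k s / α s * β s ^ 2) (fun s hs' =>
        mul_nonneg (div_nonneg (hγ.pos k s h1 (Nat.lt_succ_iff.1 (Finset.mem_range.1 hs'))).le
          (hs.alpha_pos s).le) (sq_nonneg _)) (Finset.mem_range.2 (by omega))
    calc γ k t = γ k t / α t * β t ^ 2 * (α t / β t ^ 2) := by field_simp
      _ ≤ _ := by gcongr

/-- Always `α ≤ min(α, β) + α²/β`: if `β ≤ α`, then already `α ≤ α²/β`. Summability of the minimum
would thus contradict `∑ α = ∞`. -/
theorem StepsizeConditions.not_summable_min {α β : ℕ → ℝ} {C : ℝ}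
    (hs : StepsizeConditions α β C) : ¬ Summable fun k => min (α k) (β k) := by
  intro h
  have hα : Summable α := by
    refine Summable.of_nonneg_of_le (fun k => (hs.alpha_pos k).le) (fun k => ?_)
      (h.add hs.alpha_sq_div_beta)
    have ha := hs.alpha_pos k
    have hb := hs.beta_pos k
    rcases le_total (α k) (β k) with hab | hab
    · rw [min_eq_left hab]
      have : 0 ≤ α k ^ 2 / β k := by positivity
      linarith
    · have : α k ≤ α k ^ 2 / β k := by
        rw [le_div_iff₀ hb, sq]
        gcongr
      rw [min_eq_right hab]
      linarith
  exact not_tendsto_nhds_of_tendsto_atTop hs.alpha_sum _ hα.hasSum.tendsto_sum_nat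

/-! ### Almost sure convergence of the iterates -/

theorem IsRun.mem {Ω : Type*} {mΩ : MeasurableSpace Ω} {P : Measure Ω} {ℱ : Filtration ℕ mΩ}
    {N d : ℕ} {X : Set (EuclideanSpace ℝ (Fin d))} {f : Fin N → EuclideanSpace ℝ (Fin d) → ℝ}
    {E : Set (Fin N × Fin N)} {A : Matrix (Fin N) (Fin N) ℝ} {b : ℕ} {α β : ℕ → ℝ}
    {x g q : ℕ → Fin N → Ω → EuclideanSpace ℝ (Fin d)}
    (h : IsRun P ℱ X f E A b α β x g q) (k : ℕ) (i : Fin N) (ω : Ω) : x k i ω ∈ X := by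
  cases k with
  | zero => exact h.initial_mem i ω
  | succ k => exact (h.update k i ω).1

theorem norm_le_sqrt_of_abs_le_one {d : ℕ} {v : EuclideanSpace ℝ (Fin d)}
    (h : ∀ c, |v c| ≤ 1) : ‖v‖ ≤ √d := by
  rw [EuclideanSpace.norm_eq]
  refine Real.sqrt_le_sqrt ?_
  calc ∑ c, ‖v c‖ ^ 2 ≤ ∑ _c : Fin d, (1 : ℝ) :=
        Finset.sum_le_sum fun c _ => pow_le_one₀ (norm_nonneg _) (h c)
    _ = d := by simp

/-- Almost surely, every agent's iterates converge to the minimizer. -/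
theorem IsRun.ae_tendsto {Ω : Type*} {mΩ : MeasurableSpace Ω} {P : Measure Ω}
    [IsProbabilityMeasure P] {ℱ : Filtration ℕ mΩ} {N d : ℕ}
    {X : Set (EuclideanSpace ℝ (Fin d))} {f : Fin N → EuclideanSpace ℝ (Fin d) → ℝ}
    {E : Set (Fin N × Fin N)} {A : Matrix (Fin N) (Fin N) ℝ} {b : ℕ} {α β : ℕ → ℝ}
    {x g q : ℕ → Fin N → Ω → EuclideanSpace ℝ (Fin d)}
    (hrun : IsRun P ℱ X f E A b α β x g q) (hX : Convex ℝ X)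
    (hf_convex : ∀ i, ConvexOn ℝ Set.univ (f i))
    {L : Fin N → NNReal} (hf_lip : ∀ i, LipschitzOnWith (L i) (f i) X)
    {μ : ℝ} (hμ : 0 < μ) (hs : StrongConvexOn X μ (objective f))
    {w : EuclideanSpace ℝ (Fin d)} (hw : w ∈ X) (hmin : IsMinOn (objective f) X w)
    (hA : IsNetworkMatrix E A) {C : ℝ} (hstep : StepsizeConditions α β C) (i₀ : Fin N) :
    ∀ᵐ ω ∂P, Tendsto (fun k => x k i₀ ω) atTop (𝓝 w) := by
  have hlip : ∀ i, LipschitzOnWith (∑ i, L i) (f i) X := fun i =>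
    (hf_lip i).weaken (Finset.single_le_sum (fun _ _ => zero_le) (Finset.mem_univ i))
  obtain ⟨ρ, hρ⟩ : ∃ ρ, ∀ y ∈ X, ‖y - w‖ ≤ ρ :=
    ⟨_, fun y hy => norm_sub_minimizer_le hlip hμ hs hw hmin hy⟩
  choose G hG using fun i => exists_subgradient_bound (hf_convex i) w ρ
  have hG' : ∀ i y, y ∈ X → ∀ v ∈ subdifferential (f i) y, ‖v‖ ≤ ∑ j, |G j| :=
    fun i y hy v hv => ((hG i y (hρ y hy) v hv).trans (le_abs_self _)).trans
      (Finset.single_le_sum (f := fun j => |G j|) (fun _ _ => abs_nonneg _) (Finset.mem_univ i))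
  -- Two points of `X` are at most `ρ + ρ` apart, coordinate errors of at most 1 give `√d`, and `β
  -- 0` bounds the decreasing `β`.
  obtain ⟨c, K, hc, hK, hone⟩ := one_step hX hlip hμ hs hw hmin hA i₀ (ρ + ρ) (√d)
    (∑ j, |G j|) (β 0)
  have hx : ∀ k i, Measurable (x k i) := fun k i =>
    (hrun.measurable_iterate k i).mono (ℱ.le k) le_rfl
  have hq : ∀ k i, Measurable (q k i) := fun k i =>
    (hrun.measurable_quantized k i).mono (ℱ.le (k + 1)) le_rfl
  have hcoord : ∀ c : Fin d, Measurable fun v : EuclideanSpace ℝ (Fin d) => v c := fun c => by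
    fun_prop
  let V : ℕ → Ω → ℝ := fun k ω => ∑ i, ‖x k i ω - w‖ ^ 2
  let ξ : ℕ → Ω → ℝ := fun k ω =>
    ∑ i, ∑ j, A i j * inner ℝ (x k i ω - w) (q k j ω - x k j ω)
  let ε : ℕ → ℝ := fun k => K * (α k ^ 2 / β k + β k ^ 2)
  have hm : ∀ k, 0 < min (α k) (β k) := fun k => lt_min (hstep.alpha_pos k) (hstep.beta_pos k)
  have hsq : Measurable fun v : EuclideanSpace ℝ (Fin d) => ‖v - w‖ ^ 2 := by fun_prop
  have hVmeas : ∀ k, Measurable[ℱ k] (V k) := fun k =>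
    Finset.measurable_fun_sum _ fun i _ => hsq.comp (hrun.measurable_iterate k i)
  have hV0 : ∀ k ω, 0 ≤ V k ω := fun k ω => Finset.sum_nonneg fun _ _ => sq_nonneg _
  have hVM : ∀ k ω, V k ω ≤ N * ρ ^ 2 := fun k ω => by
    calc V k ω ≤ ∑ _i : Fin N, ρ ^ 2 := Finset.sum_le_sum fun i _ =>
          pow_le_pow_left₀ (norm_nonneg _) (hρ _ (hrun.mem k i ω)) 2
      _ = N * ρ ^ 2 := by simp
  have hVi : ∀ k, Integrable (V k) P := fun k =>
    Integrable.of_bound ((hVmeas k).mono (ℱ.le k) le_rfl).aestronglyMeasurable (N * ρ ^ 2)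
      (Eventually.of_forall fun ω => by rw [Real.norm_of_nonneg (hV0 k ω)]; exact hVM k ω)
  have hpath : ∀ k, ∀ᵐ ω ∂P, V (k + 1) ω
      ≤ (V k ω - c * min (α k) (β k) * V k ω + ε k) + 2 * β k * ξ k ω := fun k => by
    have hQ : ∀ᵐ ω ∂P, ∀ i (c : Fin d), |q k i ω c - x k i ω c| ≤ 1 :=
      ae_all_iff.2 fun i => ae_all_iff.2 fun c =>
        (hrun.quantized k i c).abs_sub_le (ℱ.le k) ((hcoord c).comp (hx k i))
          ((hcoord c).comp (hq k i))
    filter_upwards [hQ] with ω hω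
    have := hone (α k) (β k) (fun i => x k i ω) (fun i => g k i ω) (fun i => q k i ω)
      (fun i => x (k + 1) i ω) (hstep.alpha_pos k) (hstep.beta_pos k)
      (hstep.beta_decreasing (Nat.zero_le k)) (fun i => hrun.mem k i ω)
      (fun i j => by
        rw [← sub_sub_sub_cancel_right _ _ w]
        exact (norm_sub_le _ _).trans
          (add_le_add (hρ _ (hrun.mem k j ω)) (hρ _ (hrun.mem k i ω))))
      (fun i => norm_le_sqrt_of_abs_le_one (hω i))
      (fun i => hG' i _ (hrun.mem k i ω) _ (hrun.subgradient_mem k i ω))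
      (fun i => hrun.subgradient_mem k i ω) (fun i => hrun.update k i ω)
    simp only [V, ξ, ε]
    rw [mul_assoc c]
    exact this
  have hlim : ∀ᵐ ω ∂P, Tendsto (fun k => V k ω) atTop (𝓝 0) := by
    refine ae_tendsto_zero_of_condExp_le (m := fun k => c * min (α k) (β k)) (ε := ε) hVmeas hV0
      hVM (fun k => (mul_pos hc (hm k)).le) ?_ (fun k => ?_) ?_ fun k => ?_
    · rw [summable_mul_left_iff hc.ne']
      exact hstep.not_summable_min
    · have := hstep.beta_pos k
      positivity
    · exact (hstep.alpha_sq_div_beta.add hstep.beta_sq).mul_left K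
    · obtain ⟨hξi, hξ⟩ := condExp_noise (ℱ.le k) A w (hrun.measurable_iterate k) (hq k)
        (hrun.quantized k) fun i ω => hρ _ (hrun.mem k i ω)
      let B : Ω → ℝ := fun ω => V k ω - c * min (α k) (β k) * V k ω + ε k
      have hBi : Integrable B P := ((hVi k).sub ((hVi k).const_mul _)).add (integrable_const _)
      have hBm : Measurable[ℱ k] B :=
        ((hVmeas k).sub ((hVmeas k).const_mul _)).add_const _
      have hni : Integrable ((2 * β k) • ξ k) P := hξi.smul (2 * β k)
      have h1 : P[V (k + 1) | ℱ k] ≤ᵐ[P] P[B + (2 * β k) • ξ k | ℱ k] :=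
        condExp_mono (hVi _) (hBi.add hni) (hpath k)
      have hB : P[B | ℱ k] = B := condExp_of_stronglyMeasurable (ℱ.le k) hBm.stronglyMeasurable hBi
      filter_upwards [h1, condExp_add hBi hni (ℱ k), condExp_smul (2 * β k) (ξ k) (ℱ k), hξ]
        with ω e1 e2 e3 e4
      have e4 : (P[ξ k | ℱ k]) ω = 0 := e4
      rw [e2, Pi.add_apply, e3, Pi.smul_apply, e4, smul_zero, add_zero, hB] at e1
      exact e1
  filter_upwards [hlim] with ω hω
  rw [tendsto_iff_norm_sub_tendsto_zero]
  have h2 : Tendsto (fun k => ‖x k i₀ ω - w‖ ^ 2) atTop (𝓝 0) :=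
    squeeze_zero (fun k => sq_nonneg _) (fun k => Finset.single_le_sum
      (f := fun i => ‖x k i ω - w‖ ^ 2) (fun _ _ => sq_nonneg _) (Finset.mem_univ i₀)) hω
  simpa [Real.sqrt_sq] using h2.sqrt

end GDSRQ

end

/-! ### Convergence of the time averages -/

theorem theorem1 {Ω : Type*} {mΩ : MeasurableSpace Ω} (P : Measure Ω) [IsProbabilityMeasure P]
    (ℱ : Filtration ℕ mΩ) {N d : ℕ}
    -- the problem: closed convex `X ⊆ ℝᵈ`, local convex functions, Lipschitz on `X`
    (X : Set (EuclideanSpace ℝ (Fin d))) (hX_closed : IsClosed X) (hX_convex : Convex ℝ X)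
    (f : Fin N → EuclideanSpace ℝ (Fin d) → ℝ)
    (hf_convex : ∀ i, ConvexOn ℝ Set.univ (f i))
    (L : Fin N → NNReal) (hf_lip : ∀ i, LipschitzOnWith (L i) (f i) X)
    (μ : ℝ) (hμ : 0 < μ) (hf_strong : StrongConvexOn X μ (GDSRQ.objective f))
    (xstar : EuclideanSpace ℝ (Fin d)) (hxstar_mem : xstar ∈ X)
    (hxstar_min : IsMinOn (GDSRQ.objective f) X xstar)
    -- the network
    (E : Set (Fin N × Fin N)) (A : Matrix (Fin N) (Fin N) ℝ) (hA : GDSRQ.IsNetworkMatrix E A)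
    -- stepsizes and time-average weights
    (α β : ℕ → ℝ) (C : ℝ) (hC : 0 < C) (hstep : GDSRQ.StepsizeConditions α β C)
    (γ : ℕ → ℕ → ℝ) (hγ : GDSRQ.WeightConditions α β μ γ)
    -- the algorithm; the time averages are initialized arbitrarily
    (b : ℕ) (x g q : ℕ → Fin N → Ω → EuclideanSpace ℝ (Fin d))
    (hrun : GDSRQ.IsRun P ℱ X f E A b α β x g q)
    (z : ℕ → Fin N → Ω → EuclideanSpace ℝ (Fin d))
    (hz : ∀ k i ω, 1 ≤ k → z k i ω = ∑ t ∈ Finset.range (k + 1), γ k t • x t i ω) :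
    ∀ i : Fin N,
      (∀ᵐ ω ∂P, Tendsto (fun k => z k i ω) atTop (𝓝 xstar)) ∧
      Tendsto (fun k => ∫⁻ ω, ENNReal.ofReal (‖z k i ω - xstar‖ ^ 2) ∂P) atTop (𝓝 0) := by
  intro i₀
  obtain ⟨ρ, hρ⟩ : ∃ ρ, ∀ y ∈ X, ‖y - xstar‖ ≤ ρ :=
    ⟨_, fun y hy => GDSRQ.norm_sub_minimizer_le (L := ∑ i, L i)
      (fun i => (hf_lip i).weaken (Finset.single_le_sum (fun _ _ => zero_le) (Finset.mem_univ i)))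
      hμ hf_strong hxstar_mem hxstar_min hy⟩
  have hconv := hrun.ae_tendsto hX_convex hf_convex hf_lip hμ hf_strong hxstar_mem hxstar_min hA
    hstep i₀
  have hγ0 : ∀ᶠ k in atTop, ∀ t ≤ k, 0 ≤ γ k t := by
    filter_upwards [eventually_ge_atTop 1] with k hk t ht using (hγ.pos k t hk ht).le
  have hγ1 : ∀ᶠ k in atTop, ∑ t ∈ Finset.range (k + 1), γ k t = 1 := by
    filter_upwards [eventually_ge_atTop 1] with k hk using hγ.sum_eq_one k hk
  have hz_lim : ∀ᵐ ω ∂P, Tendsto (fun k => z k i₀ ω) atTop (𝓝 xstar) := by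
    filter_upwards [hconv] with ω hω
    refine (GDSRQ.tendsto_weighted_average hγ0 hγ1 (hγ.tendsto_zero hstep) hω).congr' ?_
    filter_upwards [eventually_ge_atTop 1] with k hk using (hz k i₀ ω hk).symm
  refine ⟨hz_lim, ?_⟩
  -- The arbitrary `z 0` need be neither in `X` nor measurable, so everything is claimed from `k =
  -- 1` on.
  have hz_mem : ∀ k ω, 1 ≤ k → z k i₀ ω ∈ X := fun k ω hk => by
    rw [hz k i₀ ω hk]
    exact hX_convex.sum_mem
      (fun t ht => (hγ.pos k t hk (Nat.lt_succ_iff.1 (Finset.mem_range.1 ht))).le)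
      (hγ.sum_eq_one k hk) fun t _ => hrun.mem t i₀ ω
  have hz_meas : ∀ k, 1 ≤ k → Measurable (z k i₀) := fun k hk => by
    rw [show z k i₀ = fun ω => ∑ t ∈ Finset.range (k + 1), γ k t • x t i₀ ω from
      funext fun ω => hz k i₀ ω hk]
    exact Finset.measurable_fun_sum _ fun t _ =>
      (measurable_const_smul (γ k t)).comp
        ((hrun.measurable_iterate t i₀).mono (ℱ.le t) le_rfl)
  have hlim : Tendsto (fun k => ∫⁻ ω, ENNReal.ofReal (‖z k i₀ ω - xstar‖ ^ 2) ∂P) atTop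
      (𝓝 (∫⁻ _ω, 0 ∂P)) := by
    refine tendsto_lintegral_filter_of_dominated_convergence
      (fun _ => ENNReal.ofReal (ρ ^ 2)) ?_ ?_ (by simp) ?_
    · filter_upwards [eventually_ge_atTop 1] with k hk
      exact (((hz_meas k hk).sub_const _).norm.pow_const 2).ennreal_ofReal
    · filter_upwards [eventually_ge_atTop 1] with k hk
      refine Eventually.of_forall fun ω => ENNReal.ofReal_le_ofReal ?_
      exact pow_le_pow_left₀ (norm_nonneg _) (hρ _ (hz_mem k ω hk)) 2
    · filter_upwards [hz_lim] with ω hω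
      have h := (tendsto_iff_norm_sub_tendsto_zero.1 hω).pow 2
      simpa using ENNReal.tendsto_ofReal h
  simpa using hlim
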